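/- Let $F$ be the distribution function of a probability distribution on $\mathbb{R}_+=[0,\infty)$, and let $\nu$ be a random variable with $\nu>0$ almost surely, with distribution $G$, such that $\mathbf{E}|\ln\nu|<\infty$. Put $\delta=\gamma+\mathbf{E}\ln\nu$, where $\gamma$ is the Euler constant. Let $\{Z_n\}_{n\ge 0}$ be a maximal branching process on $\mathbb{R}_+$ in the power-law random environment given by $F$ and $G$, that is, a homogeneous Markov chain with values in $\mathbb{R}_+$, with arbitrary initial distribution and with transition probabilities $$\mathbf{P}(Z_{n+1}\le y\mid Z_n=x)=\mathbf{E}\bigl[(F(y)^{\nu})^{x}\bigr],\qquad x,y\in\mathbb{R}_+$$ (where $0^0=1$). If $$\limsup_{x\to+\infty}x(-\ln F(x))<e^{-\delta}\qquad\text{and}\qquad F(0)>0,$$ then the process degenerates almost surely: with probability $1$ there is a (random) $N$ such that $Z_n=0$ for all $n\ge N$. -/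

import Mathlib

open MeasureTheory Filter
open scoped NNReal

/-- The distribution function `F(y) = D([0, y])` of a distribution `D` on `ℝ₊ = [0, ∞)`. -/
noncomputable def distFun (D : Measure ℝ≥0) (y : ℝ≥0) : ℝ := D.real (Set.Iic y)

/-- The history of a process up to time `n`, i.e. the σ-algebra generated by `Z 0, …, Z n`. -/
@[reducible] def history {Ω : Type*} (Z : ℕ → Ω → ℝ≥0) (n : ℕ) : MeasurableSpace Ω :=
  ⨆ k ≤ n, MeasurableSpace.comap (Z k) inferInstance

/-- `Z` is a maximal branching process on `ℝ₊` in the random environment given by a family of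
distribution functions `Fs s`, `s > 0`, and a distribution `G` of the environment variable `ν`:
a homogeneous Markov chain with
`P(Z (n+1) ≤ y | Z n = x) = E ((Fs ν y) ^ x)` (where `0 ^ 0 = 1`), with arbitrary initial law. -/
structure IsMBPRE {Ω : Type*} [MeasurableSpace Ω] (P : Measure Ω)
    (Fs : ℝ → ℝ≥0 → ℝ) (G : Measure ℝ) (Z : ℕ → Ω → ℝ≥0) : Prop where
  measurable : ∀ n, Measurable (Z n)
  transition : ∀ (n : ℕ) (y : ℝ≥0),
    P[Set.indicator {ω | Z (n + 1) ω ≤ y} (fun _ => (1 : ℝ)) | history Z n]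
      =ᵐ[P] fun ω => ∫ s, (Fs s y) ^ (Z n ω : ℝ) ∂G

/-- `Z` is a maximal branching process on `ℝ₊` in a power-law random environment:
`Fs s = F ^ s`, where `F` is the distribution function of `D`. -/
def IsMBPPLRE {Ω : Type*} [MeasurableSpace Ω] (P : Measure Ω)
    (D : Measure ℝ≥0) (G : Measure ℝ) (Z : ℕ → Ω → ℝ≥0) : Prop :=
  IsMBPRE P (fun s y => (distFun D y) ^ s) G Z

/-- The constant `δ = γ + E ln ν`, where `ν` has distribution `G` and `γ` is Euler's constant. -/
noncomputable def envDelta (G : Measure ℝ) : ℝ :=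
  Real.eulerMascheroniConstant + ∫ s, Real.log s ∂G

open ProbabilityTheory

/-! The proof is a Foster–Lyapunov argument on a logarithmic scale. If `-ln F(y) ≤ c/y` for `y ≥ A`,
then from state `x` the tail of the next state above `A` is dominated by that of `c x ν / e`, with
`e` standard exponential and independent of `ν` (`ofReal_one_sub_integral_le_mixedTail`). Since `E
ln e = -γ`, the logarithm of that variable has mean `ln x + ln c + δ`, and the limsup hypothesis
allows `ln c + δ < 0`: the logarithm drifts down from large states. From bounded positive states,
`F(0) > 0` gives a probability of jumping to 0 bounded below, which an extra weight `M` on `{x > 0}`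
turns into drift (`exists_lyapunovStep_add_le`). Summing the drift bounds `∑ P(Z n > 0, Z 0 ≤ K)`,
and Borel–Cantelli concludes. -/

/-! ### Logarithmic moment of the exponential law. -/

/-- Both sides are `Γ'(1)`, the left one by differentiation under the integral sign. -/
lemma integral_log_mul_exp_neg :
    ∫ t in Set.Ioi (0 : ℝ), Real.log t * Real.exp (-t) = -Real.eulerMascheroniConstant := by
  have h1 := Complex.hasDerivAt_GammaIntegral (s := 1) (by simp)
  have h2 : HasDerivAt Complex.GammaIntegral (-Real.eulerMascheroniConstant : ℂ) 1 := by
    refine Complex.hasDerivAt_Gamma_one.congr_of_eventuallyEq ?_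
    have : {s : ℂ | 0 < s.re} ∈ nhds (1 : ℂ) :=
      (isOpen_lt continuous_const Complex.continuous_re).mem_nhds (by simp)
    filter_upwards [this] with s hs using (Complex.Gamma_eq_integral hs).symm
  have h3 := h1.unique h2
  simp only [sub_self, Complex.cpow_zero, one_mul] at h3
  rw [← Complex.ofReal_inj, Complex.ofReal_neg, ← h3, ← integral_complex_ofReal]
  simp

lemma integrableOn_log_mul_exp_neg :
    IntegrableOn (fun t : ℝ => Real.log t * Real.exp (-t)) (Set.Ioi 0) := by
  -- The Bochner integral of a non-integrable function is zero, and `γ ≠ 0`.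
  refine Integrable.of_integral_ne_zero ?_
  rw [integral_log_mul_exp_neg]
  have := Real.one_half_lt_eulerMascheroniConstant
  linarith

lemma expMeasure_one_eq_withDensity :
    expMeasure 1 = (volume.restrict (Set.Ioi 0)).withDensity
      fun t : ℝ => ((Real.exp (-t)).toNNReal : ENNReal) := by
  rw [← restrict_withDensity measurableSet_Ioi, restrict_withDensity measurableSet_Ioi,
    ← withDensity_indicator measurableSet_Ioi]
  refine withDensity_congr_ae ?_
  filter_upwards [Measure.ae_ne volume (0 : ℝ)] with t ht
  have h := exponentialPDF_eq 1 t
  rw [exponentialPDF, exponentialPDFReal] at h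
  rw [gammaPDF, h, Set.indicator_apply]
  rcases lt_or_gt_of_ne ht with h0 | h0
  · simp [h0.not_ge, h0.le]
  · simp [h0.le, h0, ENNReal.ofReal]

lemma integrable_log_expMeasure : Integrable Real.log (expMeasure 1) := by
  rw [expMeasure_one_eq_withDensity, integrable_withDensity_iff_integrable_smul (by fun_prop)]
  refine integrableOn_log_mul_exp_neg.congr (Eventually.of_forall fun t => ?_)
  simp [NNReal.smul_def, Real.exp_nonneg, mul_comm]

lemma integral_log_expMeasure :
    ∫ t, Real.log t ∂(expMeasure 1) = -Real.eulerMascheroniConstant := by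
  rw [expMeasure_one_eq_withDensity, integral_withDensity_eq_integral_smul (by fun_prop),
    ← integral_log_mul_exp_neg]
  refine integral_congr_ae (Eventually.of_forall fun t => ?_)
  simp [NNReal.smul_def, Real.exp_nonneg, mul_comm]

lemma expMeasure_Iic {x : ℝ} (hx : 0 ≤ x) :
    expMeasure 1 (Set.Iic x) = ENNReal.ofReal (1 - Real.exp (-x)) := by
  have := isProbabilityMeasure_expMeasure one_pos
  rw [← ofReal_measureReal, ← cdf_eq_real, cdf_expMeasure_eq one_pos, if_pos hx, one_mul]

lemma ae_pos_expMeasure : ∀ᵐ t ∂(expMeasure 1), 0 < t := by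
  have := expMeasure_Iic le_rfl
  simp only [neg_zero, Real.exp_zero, sub_self, ENNReal.ofReal_zero] at this
  rw [ae_iff]
  simpa [Set.Iic, not_lt] using this

/-- For an integrable `X` and large `L`, the mean of `(L + X)⁺` is close to `L + E X`. -/
lemma exists_lintegral_ofReal_add_le {α : Type*} [MeasurableSpace α] {Q : Measure α}
    [IsProbabilityMeasure Q] {X : α → ℝ} (hX : Integrable X Q) {ε : ℝ} (hε : 0 < ε) :
    ∃ L₀ : ℝ, ∀ L ≥ L₀,
      ∫⁻ a, ENNReal.ofReal (L + X a) ∂Q ≤ ENNReal.ofReal (L + ∫ a, X a ∂Q + ε) := by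
  -- The excess of `E (L + X)⁺` over `L + E X` is the mean negative part, which vanishes as `L → ∞`
  -- by domination by `|X|`.
  have hneg : Tendsto (fun L : ℝ => ∫ a, max (-(L + X a)) 0 ∂Q) atTop (nhds (∫ _, (0 : ℝ) ∂Q)) := by
    refine tendsto_integral_filter_of_dominated_convergence (fun a => |X a|) ?_ ?_ hX.abs ?_
    · exact Eventually.of_forall fun L => by
        have := hX.aestronglyMeasurable
        exact ((aestronglyMeasurable_const.add this).neg).sup aestronglyMeasurable_const
    · filter_upwards [eventually_ge_atTop 0] with L hL
      refine Eventually.of_forall fun a => ?_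
      rw [Real.norm_of_nonneg (le_max_right _ _)]
      refine max_le ?_ (abs_nonneg _)
      have := neg_le_abs (X a)
      linarith
    · refine Eventually.of_forall fun a => tendsto_const_nhds.congr' ?_
      filter_upwards [eventually_ge_atTop (-X a)] with L hL
      rw [max_eq_right]
      linarith
  rw [integral_zero] at hneg
  obtain ⟨L₀, h⟩ := eventually_atTop.1 (hneg.eventually_lt_const hε)
  refine ⟨L₀, fun L hL => ?_⟩
  have hint : Integrable (fun a => L + X a) Q := (integrable_const L).add hX
  have heq : ∀ a, max (L + X a) 0 = (L + X a) + max (-(L + X a)) 0 := fun a => by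
    rcases le_total (L + X a) 0 with h | h
    · rw [max_eq_right h, max_eq_left (by linarith)]; ring
    · rw [max_eq_left h, max_eq_right (by linarith)]; ring
  calc ∫⁻ a, ENNReal.ofReal (L + X a) ∂Q
      = ∫⁻ a, ENNReal.ofReal (max (L + X a) 0) ∂Q := by simp [ENNReal.ofReal_max]
    _ = ENNReal.ofReal (∫ a, max (L + X a) 0 ∂Q) :=
        (ofReal_integral_eq_lintegral_ofReal hint.pos_part
          (Eventually.of_forall fun a => le_max_right _ _)).symm
    _ ≤ _ := by
        refine ENNReal.ofReal_le_ofReal ?_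
        simp_rw [heq]
        rw [integral_add hint hint.neg_part, integral_add (integrable_const L) hX]
        have := h L hL
        rw [integral_const, probReal_univ, one_smul]
        linarith

/-! ### The dominating Fréchet-type variable. -/

/-- The probability that the Fréchet-type variable `c * x * s / e`, with `s` of law `G` and `e` an
independent standard exponential variable, is at least `y`. -/
noncomputable def mixedTail (G : Measure ℝ) (c x y : ℝ) : ENNReal :=
  (G.prod (expMeasure 1)) {p | p.2 * y ≤ p.1 * (c * x)}

instance : IsProbabilityMeasure (expMeasure 1) := isProbabilityMeasure_expMeasure one_pos

lemma ae_prod_pos {G : Measure ℝ} [IsProbabilityMeasure G] (hG : ∀ᵐ s ∂G, 0 < s) :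
    ∀ᵐ p ∂(G.prod (expMeasure 1)), 0 < p.1 ∧ 0 < p.2 :=
  (Measure.quasiMeasurePreserving_fst.ae hG).and
    (Measure.quasiMeasurePreserving_snd.ae ae_pos_expMeasure)

lemma measurable_mixedTail {α : Type*} [MeasurableSpace α] (G : Measure ℝ) [IsProbabilityMeasure G]
    (c : ℝ) {f g : α → ℝ} (hf : Measurable f) (hg : Measurable g) :
    Measurable fun a => mixedTail G c (f a) (g a) := by
  have hs : MeasurableSet {q : α × (ℝ × ℝ) | q.2.2 * g q.1 ≤ q.2.1 * (c * f q.1)} :=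
    measurableSet_le (by fun_prop) (by fun_prop)
  exact measurable_measure_prodMk_left hs

lemma mixedTail_zero {G : Measure ℝ} [IsProbabilityMeasure G] (hG : ∀ᵐ s ∂G, 0 < s)
    (c : ℝ) {y : ℝ} (hy : 0 < y) : mixedTail G c 0 y = 0 := by
  rw [mixedTail, measure_eq_zero_iff_ae_notMem]
  filter_upwards [ae_prod_pos hG] with p hp
  have := mul_pos hp.2 hy
  simpa using this

lemma mixedTail_mono {G : Measure ℝ} [IsProbabilityMeasure G] (hG : ∀ᵐ s ∂G, 0 < s)
    {c : ℝ} (hc : 0 ≤ c) (y : ℝ) : Monotone fun x => mixedTail G c x y := by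
  intro x x' h
  refine measure_mono_ae ?_
  filter_upwards [ae_prod_pos hG] with p hp h1
  exact le_trans (show p.2 * y ≤ p.1 * (c * x) from h1)
    (mul_le_mul_of_nonneg_left (mul_le_mul_of_nonneg_left h hc) hp.1.le)

lemma rpow_rpow_bounds {F s x : ℝ} (h0 : 0 < F) (h1 : F ≤ 1) (hs : 0 < s) (hx : 0 ≤ x) :
    0 < (F ^ s) ^ x ∧ (F ^ s) ^ x ≤ 1 :=
  ⟨Real.rpow_pos_of_pos (Real.rpow_pos_of_pos h0 _) _,
    Real.rpow_le_one (Real.rpow_nonneg h0.le _) (Real.rpow_le_one h0.le h1 hs.le) hx⟩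

lemma integrable_rpow_rpow {G : Measure ℝ} [IsProbabilityMeasure G] (hG : ∀ᵐ s ∂G, 0 < s)
    {F x : ℝ} (h0 : 0 < F) (h1 : F ≤ 1) (hx : 0 ≤ x) :
    Integrable (fun s => (F ^ s) ^ x) G := by
  refine Integrable.of_bound (C := 1) ?_ ?_
  · exact ((measurable_const.pow measurable_id).pow measurable_const).aestronglyMeasurable
  · filter_upwards [hG] with s hs
    have := rpow_rpow_bounds h0 h1 hs hx
    rw [Real.norm_of_nonneg this.1.le]
    exact this.2

lemma integral_rpow_rpow_le_one {G : Measure ℝ} [IsProbabilityMeasure G] (hG : ∀ᵐ s ∂G, 0 < s)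
    {F x : ℝ} (h0 : 0 < F) (h1 : F ≤ 1) (hx : 0 ≤ x) :
    ∫ s, (F ^ s) ^ x ∂G ≤ 1 := by
  have := integral_mono_ae (integrable_rpow_rpow hG h0 h1 hx) (integrable_const (1 : ℝ))
    (by filter_upwards [hG] with s hs using (rpow_rpow_bounds h0 h1 hs hx).2)
  simpa using this

lemma integral_rpow_rpow_pos {G : Measure ℝ} [IsProbabilityMeasure G] (hG : ∀ᵐ s ∂G, 0 < s)
    {F x : ℝ} (h0 : 0 < F) (h1 : F ≤ 1) (hx : 0 ≤ x) :
    0 < ∫ s, (F ^ s) ^ x ∂G := by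
  have hpos : ∀ s : ℝ, 0 < (F ^ s) ^ x := fun s => Real.rpow_pos_of_pos (Real.rpow_pos_of_pos h0 _) _
  rw [integral_pos_iff_support_of_nonneg (fun s => (hpos s).le)
    (integrable_rpow_rpow hG h0 h1 hx)]
  have : Function.support (fun s : ℝ => (F ^ s) ^ x) = Set.univ := by
    ext s; simpa using (hpos s).ne'
  simp [this]

lemma integral_rpow_rpow_anti {G : Measure ℝ} [IsProbabilityMeasure G] (hG : ∀ᵐ s ∂G, 0 < s)
    {F x x' : ℝ} (h0 : 0 < F) (h1 : F ≤ 1) (hx : 0 ≤ x) (h : x ≤ x') :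
    ∫ s, (F ^ s) ^ x' ∂G ≤ ∫ s, (F ^ s) ^ x ∂G := by
  refine integral_mono_ae (integrable_rpow_rpow hG h0 h1 (hx.trans h))
    (integrable_rpow_rpow hG h0 h1 hx) ?_
  filter_upwards [hG] with s hs
  exact Real.rpow_le_rpow_of_exponent_ge (Real.rpow_pos_of_pos h0 _)
    (Real.rpow_le_one h0.le h1 hs.le) h

/-- For fixed `s`, `F ^ (s x) ≥ exp (-s c x / y)`, and one minus the right side is the probability
that `e ≤ s c x / y`. -/
lemma ofReal_one_sub_integral_le_mixedTail {G : Measure ℝ} [IsProbabilityMeasure G]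
    (hG : ∀ᵐ s ∂G, 0 < s) {F c x y : ℝ} (h0 : 0 < F) (h1 : F ≤ 1) (hc : 0 ≤ c) (hx : 0 ≤ x)
    (hy : 0 < y) (hF : y * (-Real.log F) ≤ c) :
    ENNReal.ofReal (1 - ∫ s, (F ^ s) ^ x ∂G) ≤ mixedTail G c x y := by
  have hint := integrable_rpow_rpow hG h0 h1 hx
  have hs : MeasurableSet {p : ℝ × ℝ | p.2 * y ≤ p.1 * (c * x)} :=
    measurableSet_le (by fun_prop) (by fun_prop)
  have e1 : 1 - ∫ s, (F ^ s) ^ x ∂G = ∫ s, (1 - (F ^ s) ^ x) ∂G := by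
    rw [integral_sub (integrable_const _) hint]; simp
  have hint' : Integrable (fun s => 1 - (F ^ s) ^ x) G := (integrable_const _).sub hint
  rw [e1, ofReal_integral_eq_lintegral_ofReal hint', mixedTail,
    Measure.prod_apply hs]
  · refine lintegral_mono_ae ?_
    filter_upwards [hG] with s hs
    have e2 : Prod.mk s ⁻¹' {p : ℝ × ℝ | p.2 * y ≤ p.1 * (c * x)}
        = Set.Iic (s * (c * x) / y) := by
      ext e; simp [le_div_iff₀ hy]
    rw [e2, expMeasure_Iic (by positivity)]
    refine ENNReal.ofReal_le_ofReal (sub_le_sub_left ?_ _)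
    rw [← Real.rpow_mul h0.le, Real.rpow_def_of_pos h0]
    refine Real.exp_le_exp.2 ?_
    have h3 : -Real.log F ≤ c / y := by rw [le_div_iff₀ hy]; linarith
    have h4 := mul_le_mul_of_nonneg_left h3 (mul_nonneg hs.le hx)
    have h5 : s * (c * x) / y = s * x * (c / y) := by ring
    rw [h5]
    linarith
  · filter_upwards [hG] with s hs
    simpa using (rpow_rpow_bounds h0 h1 hs hx).2

/-- Layer-cake formula for the positive part of `log (c x s / (A e))`; `ENNReal.ofReal` does the
truncation. -/
lemma lintegral_mixedTail {G : Measure ℝ} [IsProbabilityMeasure G] (hG : ∀ᵐ s ∂G, 0 < s)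
    {c x A : ℝ} (hc : 0 < c) (hx : 0 < x) (hA : 0 < A) :
    ∫⁻ t in Set.Ioi (0 : ℝ), mixedTail G c x (A * Real.exp t) =
      ∫⁻ p, ENNReal.ofReal (Real.log (c * x / A) + (Real.log p.1 - Real.log p.2))
        ∂(G.prod (expMeasure 1)) := by
  have h := lintegral_eq_lintegral_meas_le (G.prod (expMeasure 1))
    (f := fun p => max (Real.log (c * x / A) + (Real.log p.1 - Real.log p.2)) 0)
    (Eventually.of_forall fun p => le_max_right _ _) (by fun_prop)
  simp only [ENNReal.ofReal_max, ENNReal.ofReal_zero, zero_le, sup_of_le_left] at h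
  rw [h]
  refine setLIntegral_congr_fun measurableSet_Ioi fun t ht => measure_congr ?_
  filter_upwards [ae_prod_pos hG] with p hp
  refine propext ?_
  change p.2 * (A * Real.exp t) ≤ p.1 * (c * x) ↔
    t ≤ max (Real.log (c * x / A) + (Real.log p.1 - Real.log p.2)) 0
  rw [le_max_iff, or_iff_left (not_le.2 ht), ← Real.log_div hp.1.ne' hp.2.ne',
    ← Real.log_mul (by positivity) (div_pos hp.1 hp.2).ne',
    Real.le_log_iff_exp_le (mul_pos (by positivity) (div_pos hp.1 hp.2)), div_mul_div_comm,
    le_div_iff₀ (mul_pos hA hp.2)]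
  constructor <;> intro h <;> linarith

lemma integrable_log_sub_log {G : Measure ℝ} [IsProbabilityMeasure G]
    (hδ : Integrable Real.log G) :
    Integrable (fun p : ℝ × ℝ => Real.log p.1 - Real.log p.2) (G.prod (expMeasure 1)) :=
  (hδ.comp_fst _).sub (integrable_log_expMeasure.comp_snd _)

lemma integral_log_sub_log {G : Measure ℝ} [IsProbabilityMeasure G]
    (hδ : Integrable Real.log G) :
    ∫ p : ℝ × ℝ, (Real.log p.1 - Real.log p.2) ∂(G.prod (expMeasure 1)) = envDelta G := by
  rw [integral_sub (hδ.comp_fst _) (integrable_log_expMeasure.comp_snd _),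
    integral_fun_fst, integral_fun_snd, integral_log_expMeasure, envDelta]
  simp
  ring

/-! ### One step of the chain. -/

lemma history_le {Ω : Type*} [m : MeasurableSpace Ω] {Z : ℕ → Ω → ℝ≥0}
    (hZ : ∀ n, Measurable (Z n)) (n : ℕ) : history Z n ≤ m :=
  iSup₂_le fun k _ => (hZ k).comap_le

lemma distFun_le_one (D : Measure ℝ≥0) [IsProbabilityMeasure D] (y : ℝ≥0) : distFun D y ≤ 1 :=
  measureReal_le_one

lemma distFun_mono (D : Measure ℝ≥0) [IsProbabilityMeasure D] : Monotone (distFun D) :=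
  fun _ _ h => measureReal_mono (Set.Iic_subset_Iic.2 h)

/-- The initial law may have no logarithmic moment, hence the restriction to `Z 0 ≤ K`; this event
lies in every `history Z n`, so the transition law can be integrated over it. -/
lemma IsMBPPLRE.restrict_tail {Ω : Type*} [MeasurableSpace Ω] {P : Measure Ω}
    [IsProbabilityMeasure P] {D : Measure ℝ≥0} [IsProbabilityMeasure D]
    {G : Measure ℝ} [IsProbabilityMeasure G] (hG : ∀ᵐ s ∂G, 0 < s)
    {Z : ℕ → Ω → ℝ≥0} (hZ : IsMBPPLRE P D G Z) (K : ℝ≥0) (n : ℕ) {y : ℝ≥0} (hF : 0 < distFun D y) :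
    P.restrict {ω | Z 0 ω ≤ K} {ω | y < Z (n + 1) ω} =
      ∫⁻ ω, ENNReal.ofReal (1 - ∫ s, (distFun D y ^ s) ^ (Z n ω : ℝ) ∂G)
        ∂(P.restrict {ω | Z 0 ω ≤ K}) := by
  have hm := history_le hZ.measurable n
  have hA : MeasurableSet[history Z n] {ω | Z 0 ω ≤ K} := by
    have h0 : MeasurableSpace.comap (Z 0) inferInstance ≤ history Z n :=
      le_iSup₂_of_le (f := fun k (_ : k ≤ n) => MeasurableSpace.comap (Z k) inferInstance)
        0 (Nat.zero_le n) le_rfl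
    exact h0 _ ⟨Set.Iic K, measurableSet_Iic, rfl⟩
  have hB : MeasurableSet {ω | Z (n + 1) ω ≤ y} :=
    measurableSet_le (hZ.measurable _) measurable_const
  have hind : Integrable (Set.indicator {ω | Z (n + 1) ω ≤ y} (fun _ => (1 : ℝ))) P :=
    (integrable_const _).indicator hB
  have htr := hZ.transition n y
  have hint := (integrable_condExp.congr htr).restrict (s := {ω | Z 0 ω ≤ K})
  have h1 := setIntegral_condExp hm hind hA
  rw [integral_congr_ae (ae_restrict_of_ae htr)] at h1
  have hcompl : {ω | y < Z (n + 1) ω} = {ω | Z (n + 1) ω ≤ y}ᶜ := by ext; simp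
  have hint' : Integrable (fun ω => 1 - ∫ s, (distFun D y ^ s) ^ (Z n ω : ℝ) ∂G)
    (P.restrict {ω | Z 0 ω ≤ K}) := (integrable_const _).sub hint
  rw [← ofReal_integral_eq_lintegral_ofReal hint', integral_sub
    (integrable_const _) hint, h1, ← ofReal_measureReal, hcompl, measureReal_compl hB]
  · simp [integral_indicator hB]
  · refine Eventually.of_forall fun ω => ?_
    simpa using integral_rpow_rpow_le_one hG hF (distFun_le_one D y) (Z n ω).2

/-! ### Lyapunov function and drift. -/

/-- The Lyapunov function `(log (x / A))⁺ + M 1{x > 0}`. -/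
noncomputable def lyapunov (A M : ℝ) (x : ℝ≥0) : ENNReal :=
  ENNReal.ofReal (Real.log (x / A)) + Set.indicator (Set.Ioi 0) (fun _ => ENNReal.ofReal M) x

/-- A bound for the mean of the Lyapunov function after one step from `x`. -/
noncomputable def lyapunovStep (G : Measure ℝ) (F c A M : ℝ) (x : ℝ≥0) : ENNReal :=
  (∫⁻ t in Set.Ioi (0 : ℝ), mixedTail G c x (A * Real.exp t)) +
    ENNReal.ofReal M * ENNReal.ofReal (1 - ∫ s, (F ^ s) ^ (x : ℝ) ∂G)

lemma exists_lyapunovStep_add_le {G : Measure ℝ} [IsProbabilityMeasure G]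
    (hG : ∀ᵐ s ∂G, 0 < s) (hδ : Integrable Real.log G) {F c A : ℝ} (hF0 : 0 < F) (hF1 : F ≤ 1)
    (hc : 0 < c) (hA : 0 < A) (hneg : Real.log c + envDelta G < 0) :
    ∃ M ε : ℝ, 0 < ε ∧ ∀ x : ℝ≥0, lyapunovStep G F c A M x +
      Set.indicator (Set.Ioi 0) (fun _ => ENNReal.ofReal ε) x ≤ lyapunov A M x := by
  -- Half of the gap `-(log c + δ)` absorbs the truncation error; the other half remains as drift.
  set ε : ℝ := -(Real.log c + envDelta G) / 2 with hε_def
  have hε : 0 < ε := by rw [hε_def]; linarith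
  obtain ⟨L₀, hL₀⟩ := exists_lintegral_ofReal_add_le (integrable_log_sub_log hδ) hε
  -- The first entry puts `log (c x / A)` beyond `L₀`; the second keeps `log (x / A) - ε`
  -- nonnegative.
  set B : ℝ := max (A * Real.exp L₀ / c) (A * Real.exp ε) with hB_def
  have hB : 0 < B := lt_max_of_lt_right (by positivity)
  have hlog : ∀ x, B ≤ x → ε ≤ Real.log (x / A) := fun x hx => by
    have hx0 := hB.trans_le hx
    rw [Real.le_log_iff_exp_le (by positivity), le_div_iff₀ hA, mul_comm]
    exact (le_max_right _ _).trans hx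
  have hlarge : ∀ x, B ≤ x → ∫⁻ t in Set.Ioi (0 : ℝ), mixedTail G c x (A * Real.exp t) ≤
      ENNReal.ofReal (Real.log (x / A) - ε) := fun x hx => by
    have hx0 := hB.trans_le hx
    have hL : L₀ ≤ Real.log (c * x / A) := by
      rw [Real.le_log_iff_exp_le (by positivity), le_div_iff₀ hA]
      have := (le_max_left _ _).trans hx
      rw [div_le_iff₀ hc] at this
      linarith
    rw [lintegral_mixedTail hG hc hx0 hA]
    refine (hL₀ _ hL).trans (ENNReal.ofReal_le_ofReal ?_)
    rw [integral_log_sub_log hδ, mul_div_assoc, Real.log_mul hc.ne' (by positivity)]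
    linarith
  set C : ℝ := Real.log (B / A) - ε with hC_def
  have hC : 0 ≤ C := by have := hlog B le_rfl; linarith
  set p : ℝ := ∫ s, (F ^ s) ^ B ∂G with hp_def
  have hp : 0 < p := integral_rpow_rpow_pos hG hF0 hF1 hB.le
  have hp1 : p ≤ 1 := integral_rpow_rpow_le_one hG hF0 hF1 hB.le
  -- Solves `C + M (1 - p) + ε = M`, where `p` is the probability of jumping from `B` to 0, the
  -- least over `x ≤ B`.
  set M : ℝ := (C + ε) / p with hM_def
  have hM : 0 ≤ M := by positivity
  refine ⟨M, ε, hε, fun x => ?_⟩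
  rw [lyapunovStep, lyapunov]
  rcases eq_zero_or_pos x with rfl | hx
  · have h0 : ∀ t : ℝ, mixedTail G c 0 (A * Real.exp t) = 0 := fun t =>
      mixedTail_zero hG c (by positivity)
    simp [h0]
  have hx' : (0 : ℝ) < x := hx
  rw [Set.indicator_of_mem (Set.mem_Ioi.2 hx), Set.indicator_of_mem (Set.mem_Ioi.2 hx)]
  rcases le_total B x with hBx | hxB
  · have h1 : ENNReal.ofReal (1 - ∫ s, (F ^ s) ^ (x : ℝ) ∂G) ≤ 1 := by
      rw [ENNReal.ofReal_le_one]
      have := integral_rpow_rpow_pos hG hF0 hF1 hx'.le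
      linarith
    calc _ ≤ ENNReal.ofReal (Real.log (x / A) - ε) + ENNReal.ofReal M * 1 + ENNReal.ofReal ε := by
          gcongr
          exact hlarge x hBx
      _ = ENNReal.ofReal (Real.log (x / A) - ε) + ENNReal.ofReal ε + ENNReal.ofReal M := by
          rw [mul_one, add_right_comm]
      _ = _ := by
          rw [← ENNReal.ofReal_add (sub_nonneg.2 (hlog x hBx)) hε.le, sub_add_cancel]
  · have h1 : 1 - ∫ s, (F ^ s) ^ (x : ℝ) ∂G ≤ 1 - p :=
      sub_le_sub_left (integral_rpow_rpow_anti hG hF0 hF1 hx'.le hxB) _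
    have h2 : ∫⁻ t in Set.Ioi (0 : ℝ), mixedTail G c x (A * Real.exp t) ≤ ENNReal.ofReal C :=
      (lintegral_mono fun t => mixedTail_mono hG hc.le _ hxB).trans (hlarge B le_rfl)
    calc _ ≤ ENNReal.ofReal C + ENNReal.ofReal M * ENNReal.ofReal (1 - p) + ENNReal.ofReal ε := by
          gcongr
      _ = ENNReal.ofReal M := by
          rw [← ENNReal.ofReal_mul hM,
            ← ENNReal.ofReal_add hC (mul_nonneg hM (sub_nonneg.2 hp1)),
            ← ENNReal.ofReal_add (add_nonneg hC (mul_nonneg hM (sub_nonneg.2 hp1))) hε.le]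
          congr 1
          rw [hM_def]
          field_simp
          ring
      _ ≤ _ := le_add_self

/-- The logarithmic part uses layer cake at levels `y = A exp t ≥ A`, where the tail bound applies;
the atom uses the transition law at `y = 0`. -/
lemma IsMBPPLRE.lintegral_lyapunov_succ_le {Ω : Type*} [MeasurableSpace Ω] {P : Measure Ω}
    [IsProbabilityMeasure P] {D : Measure ℝ≥0} [IsProbabilityMeasure D]
    {G : Measure ℝ} [IsProbabilityMeasure G] (hG : ∀ᵐ s ∂G, 0 < s)
    {Z : ℕ → Ω → ℝ≥0} (hZ : IsMBPPLRE P D G Z) (hF0 : 0 < distFun D 0) {c : ℝ} {A : ℝ≥0}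
    (hc : 0 ≤ c) (hA : 0 < A) (hF : ∀ y ≥ A, (y : ℝ) * (-Real.log (distFun D y)) ≤ c)
    (M : ℝ) (K : ℝ≥0) (n : ℕ) :
    ∫⁻ ω, lyapunov A M (Z (n + 1) ω) ∂(P.restrict {ω | Z 0 ω ≤ K}) ≤
      ∫⁻ ω, lyapunovStep G (distFun D 0) c A M (Z n ω) ∂(P.restrict {ω | Z 0 ω ≤ K}) := by
  have hZm := hZ.measurable
  set μ := P.restrict {ω | Z 0 ω ≤ K} with hμ
  have hpos : ∀ y, 0 < distFun D y := fun y => hF0.trans_le (distFun_mono D zero_le)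
  have hA' : (0 : ℝ) < A := hA
  have hjoint : Measurable fun q : ℝ × Ω => mixedTail G c (Z n q.2) (A * Real.exp q.1) :=
    measurable_mixedTail G c (by fun_prop) (by fun_prop)
  have hlogpart : ∫⁻ ω, ENNReal.ofReal (Real.log (Z (n + 1) ω / A)) ∂μ ≤
      ∫⁻ ω, (∫⁻ t in Set.Ioi (0 : ℝ), mixedTail G c (Z n ω) (A * Real.exp t)) ∂μ := by
    have h := lintegral_eq_lintegral_meas_lt μ
      (f := fun ω => max (Real.log (Z (n + 1) ω / A)) 0)
      (Eventually.of_forall fun ω => le_max_right _ _) (by fun_prop)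
    simp only [ENNReal.ofReal_max, ENNReal.ofReal_zero, zero_le, sup_of_le_left] at h
    rw [h, ← lintegral_lintegral_swap (f := fun t ω => mixedTail G c (Z n ω) (A * Real.exp t))
      hjoint.aemeasurable]
    refine setLIntegral_mono' measurableSet_Ioi fun t ht => ?_
    have ht0 : 0 < t := ht
    set y : ℝ≥0 := A * (Real.exp t).toNNReal with hy
    have hyr : (y : ℝ) = A * Real.exp t := by
      rw [hy, NNReal.coe_mul, Real.coe_toNNReal _ (Real.exp_nonneg t)]
    have hAy : A ≤ y := by
      rw [← NNReal.coe_le_coe, hyr]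
      exact le_mul_of_one_le_right hA'.le (Real.one_le_exp ht0.le)
    have hsub : {ω | t < max (Real.log (Z (n + 1) ω / A)) 0} ⊆ {ω | y < Z (n + 1) ω} := by
      intro ω hω
      have h1 : t < Real.log (Z (n + 1) ω / A) :=
        (lt_max_iff.1 hω).resolve_right (not_lt.2 ht0.le)
      have hz : (0 : ℝ) < Z (n + 1) ω / A := by
        refine lt_of_le_of_ne (by positivity) fun h0 => ?_
        rw [← h0, Real.log_zero] at h1
        exact absurd h1 (not_lt.2 ht0.le)
      rw [Real.lt_log_iff_exp_lt hz, lt_div_iff₀ hA', mul_comm] at h1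
      change y < Z (n + 1) ω
      rw [← NNReal.coe_lt_coe, hyr]
      exact h1
    refine (measure_mono hsub).trans ?_
    rw [hμ, hZ.restrict_tail hG K n (hpos y)]
    refine lintegral_mono fun ω => ?_
    rw [← hyr]
    exact ofReal_one_sub_integral_le_mixedTail hG (hpos y) (distFun_le_one D y) hc (Z n ω).2
      (hA.trans_le hAy) (hF y hAy)
  have hatom : ∫⁻ ω, Set.indicator (Set.Ioi 0) (fun _ => ENNReal.ofReal M) (Z (n + 1) ω) ∂μ =
      ∫⁻ ω, ENNReal.ofReal M *
        ENNReal.ofReal (1 - ∫ s, (distFun D 0 ^ s) ^ (Z n ω : ℝ) ∂G) ∂μ := by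
    rw [lintegral_const_mul' _ _ ENNReal.ofReal_ne_top, ← hZ.restrict_tail hG K n hF0]
    change ∫⁻ ω, Set.indicator {ω | 0 < Z (n + 1) ω} (fun _ => ENNReal.ofReal M) ω ∂μ = _
    rw [lintegral_indicator (measurableSet_lt measurable_const (hZm _)), setLIntegral_const]
  have hlog_meas : Measurable fun ω => ENNReal.ofReal (Real.log (Z (n + 1) ω / A)) := by fun_prop
  have hstep_meas : Measurable fun ω =>
      ∫⁻ t in Set.Ioi (0 : ℝ), mixedTail G c (Z n ω) (A * Real.exp t) :=
    Measurable.lintegral_prod_left' hjoint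
  simp only [lyapunov, lyapunovStep]
  rw [lintegral_add_left hlog_meas, lintegral_add_left hstep_meas, hatom]
  gcongr

theorem corollary1 {Ω : Type*} [MeasurableSpace Ω] (P : Measure Ω) [IsProbabilityMeasure P]
    (D : Measure ℝ≥0) [IsProbabilityMeasure D]
    (G : Measure ℝ) [IsProbabilityMeasure G] (hG : ∀ᵐ s ∂G, 0 < s)
    (hδ : Integrable Real.log G)
    (Z : ℕ → Ω → ℝ≥0) (hZ : IsMBPPLRE P D G Z)
    (hF : limsup (fun x : ℝ≥0 => (((x : ℝ) * (-Real.log (distFun D x)) : ℝ) : EReal)) atTop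
      < ((Real.exp (-envDelta G) : ℝ) : EReal))
    (hF0 : 0 < distFun D 0) :
    ∀ᵐ ω ∂P, ∃ N : ℕ, ∀ n ≥ N, Z n ω = 0 := by
  have hZm := hZ.measurable
  obtain ⟨c, hc, hcδ, A, hA, hFA⟩ : ∃ c : ℝ, 0 < c ∧ Real.log c + envDelta G < 0 ∧
      ∃ A : ℝ≥0, 0 < A ∧ ∀ y ≥ A, (y : ℝ) * (-Real.log (distFun D y)) ≤ c := by
    obtain ⟨r, hr, hrδ⟩ := EReal.lt_iff_exists_real_btwn.1 hF
    rw [EReal.coe_lt_coe_iff] at hrδ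
    obtain ⟨A, hA⟩ := eventually_atTop.1 (eventually_lt_of_limsup_lt hr)
    have he := Real.exp_pos (-envDelta G)
    -- The maximum makes `c` positive, whatever the sign of `r`, and keeps it below `exp (-δ)`.
    have hc : 0 < max r (Real.exp (-envDelta G) / 2) := lt_max_of_lt_right (by positivity)
    refine ⟨_, hc, ?_, max A 1, lt_max_of_lt_right one_pos, fun y hy => ?_⟩
    · have := (Real.log_lt_iff_lt_exp hc).2 (max_lt hrδ (half_lt_self he))
      linarith
    · exact (EReal.coe_lt_coe_iff.1 (hA y ((le_max_left _ _).trans hy))).le.trans (le_max_left _ _)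
  obtain ⟨M, ε, hε, hdrift⟩ := exists_lyapunovStep_add_le hG hδ hF0 (distFun_le_one D 0) hc
    (NNReal.coe_pos.2 hA) hcδ
  have hlocal : ∀ K : ℕ, ∀ᵐ ω ∂P, Z 0 ω ≤ K → ∃ N : ℕ, ∀ n ≥ N, Z n ω = 0 := by
    intro K
    have hK : MeasurableSet {ω | Z 0 ω ≤ K} := measurableSet_le (hZm 0) measurable_const
    refine (ae_restrict_iff' hK).1 ?_
    set μ := P.restrict {ω | Z 0 ω ≤ (K : ℝ≥0)} with hμ
    set a : ℕ → ENNReal := fun n => ∫⁻ ω, lyapunov A M (Z n ω) ∂μ with ha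
    set S : ℕ → Set Ω := fun n => {ω | 0 < Z n ω} with hS
    have hSm : ∀ n, MeasurableSet (S n) := fun n => measurableSet_lt measurable_const (hZm n)
    have hstep : ∀ n, a (n + 1) + ENNReal.ofReal ε * μ (S n) ≤ a n := fun n => by
      have hind : ENNReal.ofReal ε * μ (S n) =
          ∫⁻ ω, Set.indicator (Set.Ioi 0) (fun _ => ENNReal.ofReal ε) (Z n ω) ∂μ := by
        change _ = ∫⁻ ω, Set.indicator (S n) (fun _ => ENNReal.ofReal ε) ω ∂μ
        rw [lintegral_indicator (hSm n), setLIntegral_const]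
      have hmeas : Measurable fun ω =>
          Set.indicator (Set.Ioi 0) (fun _ => ENNReal.ofReal ε) (Z n ω) :=
        (measurable_const.indicator measurableSet_Ioi).comp (hZm n)
      calc a (n + 1) + ENNReal.ofReal ε * μ (S n)
          ≤ (∫⁻ ω, lyapunovStep G (distFun D 0) c A M (Z n ω) ∂μ) +
            ∫⁻ ω, Set.indicator (Set.Ioi 0) (fun _ => ENNReal.ofReal ε) (Z n ω) ∂μ := by
            rw [hind]
            gcongr
            exact hZ.lintegral_lyapunov_succ_le hG hF0 hc.le hA hFA M K n
        _ = ∫⁻ ω, (lyapunovStep G (distFun D 0) c A M (Z n ω) +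
            Set.indicator (Set.Ioi 0) (fun _ => ENNReal.ofReal ε) (Z n ω)) ∂μ :=
            (lintegral_add_right _ hmeas).symm
        _ ≤ a n := lintegral_mono fun ω => hdrift _
    -- Telescoped drift; with `a 0` finite it makes `∑ μ (S n)` finite.
    have hsum : ∀ N, a N + ENNReal.ofReal ε * ∑ n ∈ Finset.range N, μ (S n) ≤ a 0 := by
      intro N
      induction N with
      | zero => simp
      | succ N ih =>
        refine le_trans ?_ ih
        rw [Finset.sum_range_succ, mul_add, add_comm (ENNReal.ofReal ε * _), ← add_assoc]
        gcongr
        exact hstep N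
    have ha0 : a 0 < ⊤ := by
      have hb : ∀ᵐ ω ∂μ, lyapunov A M (Z 0 ω) ≤
          ENNReal.ofReal (K / A) + ENNReal.ofReal M := by
        refine (ae_restrict_iff' hK).2 (Eventually.of_forall fun ω hω => ?_)
        have hω' : (Z 0 ω : ℝ) ≤ K := by exact_mod_cast hω
        refine add_le_add (ENNReal.ofReal_le_ofReal ?_)
          (Set.indicator_apply_le' (fun _ => le_rfl) fun _ => zero_le)
        exact (Real.log_le_self (by positivity)).trans (by gcongr)
      refine (lintegral_mono_ae hb).trans_lt ?_
      rw [lintegral_const]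
      exact ENNReal.mul_lt_top (by finiteness) (measure_lt_top _ _)
    have htsum : ∑' n, μ (S n) ≠ ⊤ := by
      intro htop
      have hle : ENNReal.ofReal ε * ∑' n, μ (S n) ≤ a 0 := by
        rw [ENNReal.tsum_eq_iSup_nat, ENNReal.mul_iSup]
        exact iSup_le fun N => le_add_self.trans (hsum N)
      rw [htop, ENNReal.mul_top (by simpa using hε)] at hle
      exact ha0.ne (top_le_iff.1 hle)
    filter_upwards [ae_eventually_notMem htsum] with ω hω
    obtain ⟨N, hN⟩ := eventually_atTop.1 hω
    exact ⟨N, fun n hn => by simpa [hS] using hN n hn⟩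
  filter_upwards [ae_all_iff.2 hlocal] with ω hω
  obtain ⟨K, hK⟩ := exists_nat_ge (Z 0 ω)
  exact hω K hK
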